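/- Consider two parallel first-come first-served single-server queues, $m\in\{1,2\}$, with unit-rate servers. Potential customers arrive according to a renewal process whose inter-arrival distribution $H$ on $[0,\infty)$ is continuous (has no atoms) and has finite mean $1/\lambda$. The service times at queue $m$ have distribution $F_m$ on $[0,\infty)$ with mean $1/\mu_m<1/\lambda$ and finite second moment (for instance, $F_m$ is light-tailed). Let $R,C>0$. An arriving customer does not observe the state and either joins queue 1, joins queue 2, or balks (action 3); inter-arrival times, service times and actions are independent. A strategy is a vector $\mathbf p=(p_1,p_2,p_3)$ in the simplex $\Delta$ of probability distributions on the three actions. Let $X=(X^{[1]},X^{[2]})$ be the pair of workloads found at arrival instants of potential customers in the steady state induced when all customers use $\mathbf p$. Joining queue $m\in\{1,2\}$ gives utility $v_m=R-C\,(X^{[m]}+Y_m)$, where $Y_m\sim F_m$ is the customer's own service time, independent of $X$; balking gives $v_3=0$. A symmetric Nash equilibrium is a strategy $\mathbf p^e\in\Delta$ such that, under the steady state induced by $\mathbf p^e$, for each $i\in\{1,2,3\}$, $p^e_i>0$ implies $i\in\arg\max_{j}\mathrm E[v_j]$. Then: 1. For every strategy $\mathbf p\in\Delta$ the chain of workload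 pairs found at successive arrival instants of potential customers has exactly one stationary distribution, and under it $\mathrm E[X^{[m]}]<\infty$ for $m=1,2$ (so that the equilibrium condition is well defined). 2. A symmetric Nash equilibrium exists. 3. If, moreover, at each queue a service time can exceed an inter-arrival time, that is, $\mathrm P(A<Y_m)>0$ for $m=1,2$ with $A\sim H$ and $Y_m\sim F_m$ independent, then there is exactly one symmetric Nash equilibrium. -/

import Mathlib

open MeasureTheory
open scoped NNReal ENNReal

noncomputable section

namespace ParallelQueues

/-- The pair of workloads at the two stations (indexed by `0, 1 : Fin 2`). -/
abbrev State := Fin 2 → ℝ≥0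

/-- The actions: `0` joins the first station, `1` joins the second station, `2` balks. -/
abbrev Action := Fin 3

/-- The workloads found by the next potential customer, when the present one finds the workloads
`x` and takes the action `i`, the service requirements at the two stations are `y`, and the next
potential customer arrives `a` time units later.  Each server works at unit rate as long as there
is work at its station (the subtraction in `ℝ≥0` is truncated at zero). -/
def nextState (x : State) (i : Action) (y : Fin 2 → ℝ≥0) (a : ℝ≥0) : State :=
  fun m => x m + (if i = m.castSucc then y m else 0) - a

/-- The law on the actions given by a strategy `p`. -/
def actionLaw (p : Action → ℝ) : Measure Action :=
  ∑ i, ENNReal.ofReal (p i) • Measure.dirac i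

/-- The law of the workloads found by the next potential customer when the workloads found by the
present one have law `π`; the workloads found, the action (drawn from the strategy `p`), the
service times (with laws `F 0`, `F 1`) and the inter-arrival time (with law `H`) are independent. -/
def nextLaw (H : Measure ℝ≥0) (F : Fin 2 → Measure ℝ≥0) (p : Action → ℝ)
    (π : Measure State) : Measure State :=
  (π.prod ((actionLaw p).prod ((Measure.pi F).prod H))).map
    (fun z => nextState z.1 z.2.1 z.2.2.1 z.2.2.2)

/-- `π` is a stationary distribution, embedded at the arrival instants of potential customers, of
the system in which all customers use the strategy `p`. -/
def IsStationary (H : Measure ℝ≥0) (F : Fin 2 → Measure ℝ≥0) (p : Action → ℝ)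
    (π : Measure State) : Prop :=
  IsProbabilityMeasure π ∧ nextLaw H F p π = π

/-- The utility of a customer who finds the workloads `x`, whose service times at the two stations
would be `y`, and who takes the given action. -/
def utility (R C : ℝ) : Action → State → (Fin 2 → ℝ≥0) → ℝ
  | 0, x, y => R - C * ((x 0 : ℝ) + (y 0 : ℝ))
  | 1, x, y => R - C * ((x 1 : ℝ) + (y 1 : ℝ))
  | 2, _, _ => 0

/-- The expected utility of action `i` for a customer who finds the system in a random state of
law `π`, independent of the customer's service times. -/
def expectedUtility (F : Fin 2 → Measure ℝ≥0) (R C : ℝ) (π : Measure State) (i : Action) : ℝ :=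
  ∫ z, utility R C i z.1 z.2 ∂(π.prod (Measure.pi F))

/-- `p` is a symmetric Nash equilibrium strategy: in the steady state that `p` induces, the
expected utilities are well defined and every action that `p` uses maximizes them. -/
def IsSymmetricNash (H : Measure ℝ≥0) (F : Fin 2 → Measure ℝ≥0) (R C : ℝ)
    (p : Action → ℝ) : Prop :=
  p ∈ stdSimplex ℝ Action ∧
    ∃ π : Measure State, IsStationary H F p π ∧
      (∀ i, Integrable (fun z : State × (Fin 2 → ℝ≥0) => utility R C i z.1 z.2)
        (π.prod (Measure.pi F))) ∧
      ∀ i, 0 < p i → ∀ j, expectedUtility F R C π j ≤ expectedUtility F R C π i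

end ParallelQueues

end

namespace ParallelQueues

open Filter Finset Topology ProbabilityTheory

/-! The workload at each station is a Lindley recursion `W' = max 0 (U + W)` with i.i.d. inputs of
negative mean. Run backward in time (Loynes), it takes the value `maxSum` of the inputs after
finitely many steps, almost surely and from every initial workload, because the partial sums tend to
`-∞`. The limit pair solves the recursion, hence is stationary; since the initial state is forgotten
in finite time, every stationary law is its law (`nextLaw_map_limitState`, `eq_map_limitState`). A
Kingman-type second-moment estimate gives finite means (`integrable_maxSum`).

The mean workload at a station depends on the strategy only through that station's own join
probability `q` (`map_netInput`). Driving the joining decisions for all `q` by the same uniform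
variables makes this mean continuous in `q` by dominated convergence (`continuous_meanWorkload`),
and strictly increasing on `[0, 1]` when a service can outlast an inter-arrival time
(`strictMonoOn_meanWorkload`).

What remains is a three-action congestion game with separable payoffs. Existence follows from the
intermediate value theorem (`exists_isEquilibrium`), with no monotonicity needed; uniqueness follows
from adding the variational inequalities of two equilibria, as each payoff strictly decreases in its
own probability (`IsEquilibrium.eq`). -/

/-! ### The backward Lindley recursion -/

/-- The backward Lindley recursion: the workload after `n` steps started from `x`, when the most
recent increment is `u 0` and the oldest one is `u (n - 1)`. -/
noncomputable def lindley : ℕ → (ℕ → ℝ) → ℝ → ℝ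
  | 0, _, x => x
  | n + 1, u, x => max 0 (u 0 + lindley n (fun k => u (k + 1)) x)

/-- The supremum of the partial sums of a sequence. -/
noncomputable def maxSum (u : ℕ → ℝ) : ℝ := ⨆ n, ∑ k ∈ range n, u k

theorem lindley_nonneg (n : ℕ) (u : ℕ → ℝ) {x : ℝ} (hx : 0 ≤ x) : 0 ≤ lindley n u x := by
  cases n with
  | zero => exact hx
  | succ n => exact le_max_left _ _

theorem sum_range_le_lindley {n k : ℕ} (hk : k ≤ n) (u : ℕ → ℝ) {x : ℝ} (hx : 0 ≤ x) :
    ∑ i ∈ range k, u i ≤ lindley n u x := by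
  induction n generalizing k u with
  | zero => simpa [Nat.le_zero.1 hk, lindley] using hx
  | succ n ih =>
    cases k with
    | zero => simp [lindley]
    | succ k =>
      rw [sum_range_succ']
      have := ih (Nat.le_of_succ_le_succ hk) (fun k => u (k + 1))
      exact le_max_of_le_right (by linarith)

/-- Unrolled, the recursion is the maximum of the first partial sums and of the full sum plus `x`.
-/
theorem lindley_le_max (n : ℕ) (u : ℕ → ℝ) (x : ℝ) {c : ℝ} (hc : ∀ k, ∑ i ∈ range k, u i ≤ c) :
    lindley n u x ≤ max c (∑ i ∈ range n, u i + x) := by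
  induction n generalizing u c with
  | zero => simp [lindley]
  | succ n ih =>
    have h0 : 0 ≤ c := by simpa using hc 0
    have h := ih (fun k => u (k + 1)) (c := c - u 0) (fun k => by
      have := hc (k + 1)
      rw [sum_range_succ'] at this
      linarith)
    rw [sum_range_succ']
    refine max_le (le_max_of_le_left h0) ?_
    rcases le_max_iff.1 h with h | h
    · exact le_max_of_le_left (by linarith)
    · exact le_max_of_le_right (by linarith)

theorem bddAbove_sum_range {u : ℕ → ℝ} {n : ℕ} (h : ∀ k, n ≤ k → ∑ i ∈ range k, u i ≤ 0) :
    BddAbove (Set.range fun k => ∑ i ∈ range k, u i) := by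
  refine ⟨lindley n u 0, ?_⟩
  rintro _ ⟨k, rfl⟩
  rcases le_total k n with hk | hk
  · exact sum_range_le_lindley hk u le_rfl
  · exact (h k hk).trans (lindley_nonneg n u le_rfl)

/-- The later partial sums cannot beat the empty one, and the initial workload has been worked off.
Having an equality at a finite `n`, and not just a limit, is what later gives uniqueness of the
stationary law and continuity in `q`. -/
theorem lindley_eq_maxSum {u : ℕ → ℝ} {n : ℕ} {x : ℝ} (hx : 0 ≤ x)
    (h : ∀ k, n ≤ k → ∑ i ∈ range k, u i ≤ 0) (hn : ∑ i ∈ range n, u i + x ≤ 0) :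
    lindley n u x = maxSum u := by
  have hb := bddAbove_sum_range h
  apply le_antisymm
  · refine (lindley_le_max n u x (c := maxSum u) (fun k => le_ciSup hb k)).trans
      (max_le le_rfl (hn.trans ?_))
    simpa [maxSum] using le_ciSup hb 0
  · refine ciSup_le fun k => ?_
    rcases le_total k n with hk | hk
    · exact sum_range_le_lindley hk u hx
    · exact (h k hk).trans (lindley_nonneg n u hx)

theorem eventually_sum_range_nonpos {u : ℕ → ℝ}
    (h : Tendsto (fun n => ∑ i ∈ range n, u i) atTop atBot) :
    ∃ n, ∀ k, n ≤ k → ∑ i ∈ range k, u i ≤ 0 :=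
  eventually_atTop.1 (h.eventually_le_atBot 0)

theorem eventually_lindley_eq_maxSum {u : ℕ → ℝ}
    (h : Tendsto (fun n => ∑ i ∈ range n, u i) atTop atBot) {x : ℝ} (hx : 0 ≤ x) :
    ∀ᶠ n in atTop, lindley n u x = maxSum u := by
  obtain ⟨N, hN⟩ := eventually_sum_range_nonpos h
  filter_upwards [eventually_ge_atTop N, h.eventually_le_atBot (-x)] with n hn hn'
  exact lindley_eq_maxSum hx (fun k hk => hN k (hn.trans hk)) (by linarith)

theorem tendsto_sum_range_shift {u : ℕ → ℝ}
    (h : Tendsto (fun n => ∑ i ∈ range n, u i) atTop atBot) :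
    Tendsto (fun n => ∑ i ∈ range n, u (i + 1)) atTop atBot := by
  have h1 := tendsto_atBot_add_const_right _ (-u 0) (h.comp (tendsto_add_atTop_nat 1))
  refine h1.congr fun n => ?_
  simp [sum_range_succ']

theorem maxSum_eq_max {u : ℕ → ℝ} (h : Tendsto (fun n => ∑ i ∈ range n, u i) atTop atBot) :
    maxSum u = max 0 (u 0 + maxSum fun k => u (k + 1)) := by
  have h1 := (tendsto_add_atTop_nat 1).eventually (eventually_lindley_eq_maxSum h le_rfl)
  have h2 := eventually_lindley_eq_maxSum (tendsto_sum_range_shift h) le_rfl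
  obtain ⟨n, hn1, hn2⟩ := (h1.and h2).exists
  rw [← hn1, ← hn2, lindley]

theorem maxSum_nonneg (u : ℕ → ℝ) : 0 ≤ maxSum u := by
  by_cases hb : BddAbove (Set.range fun k => ∑ i ∈ range k, u i)
  · simpa [maxSum] using le_ciSup hb 0
  -- An unbounded supremum has the default value `0`.
  · exact (Real.iSup_of_not_bddAbove hb).ge

theorem maxSum_mono {u v : ℕ → ℝ} (huv : ∀ k, u k ≤ v k)
    (h : Tendsto (fun n => ∑ i ∈ range n, v i) atTop atBot) : maxSum u ≤ maxSum v := by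
  obtain ⟨n, hn⟩ := eventually_sum_range_nonpos h
  exact ciSup_mono (bddAbove_sum_range hn) fun k => sum_le_sum fun i _ => huv i

theorem lindley_le_succ (n : ℕ) (u : ℕ → ℝ) : lindley n u 0 ≤ lindley (n + 1) u 0 := by
  induction n generalizing u with
  | zero => exact le_max_left _ _
  | succ n ih => exact max_le_max le_rfl (add_le_add le_rfl (ih _))

theorem lindley_congr {n : ℕ} {u v : ℕ → ℝ} (h : ∀ k < n, u k = v k) (x : ℝ) :
    lindley n u x = lindley n v x := by
  induction n generalizing u v with
  | zero => rfl
  | succ n ih =>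
    rw [lindley, lindley, h 0 n.succ_pos, ih fun k hk => h (k + 1) (Nat.succ_lt_succ hk)]

theorem measurable_lindley (n : ℕ) (x : ℝ) : Measurable fun u : ℕ → ℝ => lindley n u x := by
  induction n with
  | zero => exact measurable_const
  | succ n ih =>
    have : Measurable fun u : ℕ → ℝ => lindley n (fun k => u (k + 1)) x :=
      ih.comp (measurable_pi_lambda _ fun k => measurable_pi_apply _)
    exact measurable_const.max ((measurable_pi_apply 0).add this)

theorem measurable_maxSum : Measurable maxSum := by
  unfold maxSum
  exact Measurable.iSup fun n => by fun_prop

/-! ### Sequences of independent and identically distributed variables -/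

variable {E : Type*} [MeasurableSpace E] (ν : Measure E) [IsProbabilityMeasure ν]

/-- The law of a sequence of independent variables with law `ν`. -/
noncomputable abbrev seqLaw : Measure (ℕ → E) := Measure.infinitePi fun _ : ℕ => ν

theorem map_cons_prod_seqLaw :
    (ν.prod (seqLaw ν)).map (fun z : E × (ℕ → E) => fun n => Nat.casesOn n z.1 z.2) =
      seqLaw ν := by
  have hm : Measurable (fun z : E × (ℕ → E) => fun n : ℕ =>
      (Nat.casesOn n z.1 z.2 : E)) := by
    refine measurable_pi_lambda _ fun n => ?_
    cases n with
    | zero => exact measurable_fst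
    | succ n => exact (measurable_pi_apply n).comp measurable_snd
  refine Measure.eq_infinitePi _ fun s t ht => ?_
  classical
  obtain ⟨N, hN⟩ := s.exists_nat_subset_range
  -- The box is padded to the index set `range (N + 1)`, which contains `0`, so that the product
  -- splits off its first factor.
  set t' : ℕ → Set E := fun i => if i ∈ s then t i else Set.univ with ht'
  have mt' : ∀ i, MeasurableSet (t' i) := fun i => by
    simp only [ht']; split_ifs
    · exact ht i
    · exact .univ
  have h1 : ∏ i ∈ s, ν (t i) = ∏ i ∈ range (N + 1), ν (t' i) := by
    rw [← prod_subset (hN.trans (range_subset_range.2 N.le_succ))]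
    · exact prod_congr rfl fun i hi => by simp [ht', hi]
    · intro i _ hi
      simp [ht', hi]
  have h2 : (fun z : E × (ℕ → E) => fun n : ℕ => (Nat.casesOn n z.1 z.2 : E)) ⁻¹'
      (Set.pi s t) = t' 0 ×ˢ Set.pi (range N) (fun i => t' (i + 1)) := by
    ext ⟨e, ω⟩
    simp only [Set.mem_preimage, Set.mem_pi, Set.mem_prod, ht', mem_coe]
    constructor
    · intro h
      refine ⟨?_, fun i _ => ?_⟩
      · split_ifs with h0
        · exact h 0 h0
        · trivial
      · split_ifs with h0
        · exact h (i + 1) h0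
        · trivial
    · rintro ⟨h0, h1⟩ i hi
      cases i with
      | zero => simpa [hi] using h0
      | succ i =>
        have := h1 i (by have := mem_range.1 (hN hi); exact mem_range.2 (by omega))
        simpa [hi] using this
  rw [Measure.map_apply hm (.pi s.countable_toSet fun i _ => ht i), h2, Measure.prod_prod,
    Measure.infinitePi_pi _ (fun i _ => mt' (i + 1)), h1, prod_range_succ', mul_comm]

theorem measurePreserving_split :
    MeasurePreserving (fun ω : ℕ → E => (ω 0, fun k => ω (k + 1))) (seqLaw ν)
      (ν.prod (seqLaw ν)) := by
  have hm : Measurable fun ω : ℕ → E => (ω 0, fun k => ω (k + 1)) :=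
    (measurable_pi_apply 0).prodMk (measurable_pi_lambda _ fun k => measurable_pi_apply _)
  have hc : Measurable (fun z : E × (ℕ → E) => fun n : ℕ =>
      (Nat.casesOn n z.1 z.2 : E)) := by
    refine measurable_pi_lambda _ fun n => ?_
    cases n with
    | zero => exact measurable_fst
    | succ n => exact (measurable_pi_apply n).comp measurable_snd
  refine ⟨hm, ?_⟩
  conv_lhs => rw [← map_cons_prod_seqLaw ν]
  rw [Measure.map_map hm hc]
  exact Measure.map_id

variable {ν}

theorem ae_tendsto_sum_atBot {U : E → ℝ} (hU : Measurable U) (hi : Integrable U ν)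
    (hneg : ∫ e, U e ∂ν < 0) :
    ∀ᵐ ω ∂(seqLaw ν), Tendsto (fun n => ∑ k ∈ range n, U (ω k)) atTop atBot := by
  have hmp : ∀ k : ℕ, MeasurePreserving (fun ω : ℕ → E => ω k) (seqLaw ν) ν := fun k =>
    measurePreserving_eval_infinitePi (fun _ : ℕ => ν) k
  have hmean : ∫ ω, U (ω 0) ∂(seqLaw ν) = ∫ e, U e ∂ν := by
    have := integral_map (μ := seqLaw ν) (hmp 0).measurable.aemeasurable
      (hU.aestronglyMeasurable (μ := Measure.map (fun ω : ℕ → E => ω 0) (seqLaw ν)))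
    rw [← this, (hmp 0).map_eq]
  have h := strong_law_ae_real (μ := seqLaw ν) (fun k ω => U (ω k))
    ((hmp 0).integrable_comp_of_integrable hi)
    (fun i j hij => (iIndepFun_infinitePi (P := fun _ : ℕ => ν) (X := fun _ => U)
      (fun _ => hU)).indepFun hij)
    (fun i => ⟨(hU.comp (hmp i).measurable).aemeasurable,
      (hU.comp (hmp 0).measurable).aemeasurable, by
        change Measure.map (U ∘ fun ω : ℕ → E => ω i) _ =
          Measure.map (U ∘ fun ω : ℕ → E => ω 0) _
        rw [← Measure.map_map hU (hmp i).measurable, ← Measure.map_map hU (hmp 0).measurable,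
          (hmp i).map_eq, (hmp 0).map_eq]⟩)
  filter_upwards [h] with ω hω
  rw [hmean] at hω
  -- The averages converge to a negative mean; multiplying back by `n` forces the sums to `-∞`.
  have h2 := hω.neg_mul_atTop hneg tendsto_natCast_atTop_atTop
  refine h2.congr' ?_
  filter_upwards [eventually_gt_atTop 0] with n hn
  have : (n : ℝ) ≠ 0 := by positivity
  field_simp

/-! ### Finite mean of the supremum of the random walk. -/

variable {E : Type*} [MeasurableSpace E] {ν : Measure E} [IsProbabilityMeasure ν]

theorem measurable_lindley_comp {U : E → ℝ} (hU : Measurable U) (n : ℕ) (x : ℝ) :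
    Measurable fun ω : ℕ → E => lindley n (fun k => U (ω k)) x :=
  (measurable_lindley n x).comp
    (measurable_pi_lambda _ fun k => hU.comp (measurable_pi_apply k))

theorem measurable_maxSum_comp {U : E → ℝ} (hU : Measurable U) :
    Measurable fun ω : ℕ → E => maxSum fun k => U (ω k) :=
  measurable_maxSum.comp (measurable_pi_lambda _ fun k => hU.comp (measurable_pi_apply k))

theorem measurePreserving_shift :
    MeasurePreserving (fun (ω : ℕ → E) k => ω (k + 1)) (seqLaw ν) (seqLaw ν) :=
  measurePreserving_snd.comp (measurePreserving_split ν)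

theorem memLp_lindley {U : E → ℝ} (hUm : Measurable U) (hU : MemLp U 2 ν) (n : ℕ) :
    MemLp (fun ω : ℕ → E => lindley n (fun k => U (ω k)) 0) 2 (seqLaw ν) := by
  induction n with
  | zero => exact MemLp.zero
  | succ n ih =>
    have h1 := hU.comp_measurePreserving (measurePreserving_eval_infinitePi (fun _ : ℕ => ν) 0)
    have h2 := ih.comp_measurePreserving measurePreserving_shift
    refine (h1.add h2).pos_part.congr_norm
      (measurable_lindley_comp hUm (n + 1) 0).aestronglyMeasurable ?_
    exact Eventually.of_forall fun ω => by simp [lindley, max_comm]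

/-- Kingman's argument. From zero, the backward iterates `Z n` increase with `n`, so `E[Z n ^ 2] ≤
E[(U + Z n) ^ 2]` with `U` independent of `Z n`; expanding and cancelling the finite `E[Z n ^ 2]`
leaves a bound on `E[Z n]` uniform in `n`. -/
theorem integral_lindley_le {U : E → ℝ} (hUm : Measurable U) (hU : MemLp U 2 ν)
    (hneg : ∫ e, U e ∂ν < 0) (n : ℕ) :
    ∫ ω, lindley n (fun k => U (ω k)) 0 ∂(seqLaw ν) ≤
      (∫ e, U e ^ 2 ∂ν) / (2 * -∫ e, U e ∂ν) := by
  set Z : ℕ → (ℕ → E) → ℝ := fun n ω => lindley n (fun k => U (ω k)) 0 with hZ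
  have hZ2 : ∀ n, MemLp (Z n) 2 (seqLaw ν) := memLp_lindley hUm hU
  have hZ0 : ∀ n ω, 0 ≤ Z n ω := fun n ω => lindley_nonneg n _ le_rfl
  have hUi : Integrable U ν := hU.integrable one_le_two
  have hZi : Integrable (Z n) (seqLaw ν) := (hZ2 n).integrable one_le_two
  have i1 : Integrable (fun z : E × (ℕ → E) => U z.1 ^ 2) (ν.prod (seqLaw ν)) :=
    hU.integrable_sq.comp_fst _
  have i2 : Integrable (fun z : E × (ℕ → E) => Z n z.2 ^ 2) (ν.prod (seqLaw ν)) :=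
    (hZ2 n).integrable_sq.comp_snd _
  have i3 : Integrable (fun z : E × (ℕ → E) => U z.1 * Z n z.2) (ν.prod (seqLaw ν)) :=
    hUi.mul_prod hZi
  have i4 : Integrable (fun z : E × (ℕ → E) => U z.1 ^ 2 + 2 * (U z.1 * Z n z.2) + Z n z.2 ^ 2)
      (ν.prod (seqLaw ν)) := (i1.add (i3.const_mul 2)).add i2
  have hsq : ∀ ω, Z n ω ^ 2 ≤ U (ω 0) ^ 2 + 2 * (U (ω 0) * Z n fun k => ω (k + 1)) +
      (Z n fun k => ω (k + 1)) ^ 2 := fun ω => by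
    calc Z n ω ^ 2 ≤ Z (n + 1) ω ^ 2 :=
          pow_le_pow_left₀ (hZ0 n ω) (lindley_le_succ n _) 2
      _ = (max 0 (U (ω 0) + Z n fun k => ω (k + 1))) ^ 2 := rfl
      _ ≤ (U (ω 0) + Z n fun k => ω (k + 1)) ^ 2 := by
          rcases max_choice 0 (U (ω 0) + Z n fun k => ω (k + 1)) with h | h
          · rw [h]; simpa using sq_nonneg _
          · rw [h]
      _ = _ := by ring
  have key := integral_mono (hZ2 n).integrable_sq
    ((measurePreserving_split ν).integrable_comp_of_integrable i4) hsq
  have e1 : ∫ ω, ((fun z : E × (ℕ → E) => U z.1 ^ 2 + 2 * (U z.1 * Z n z.2) + Z n z.2 ^ 2) ∘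
      fun ω : ℕ → E => (ω 0, fun k => ω (k + 1))) ω ∂(seqLaw ν) =
      ∫ e, U e ^ 2 ∂ν + 2 * ((∫ e, U e ∂ν) * ∫ ω, Z n ω ∂(seqLaw ν)) +
        ∫ ω, Z n ω ^ 2 ∂(seqLaw ν) := by
    have := integral_map (μ := seqLaw ν) (measurePreserving_split ν).measurable.aemeasurable
      (f := fun z : E × (ℕ → E) => U z.1 ^ 2 + 2 * (U z.1 * Z n z.2) + Z n z.2 ^ 2)
      (by rw [(measurePreserving_split ν).map_eq]; exact i4.aestronglyMeasurable)
    simp only [Function.comp_def]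
    rw [← this, (measurePreserving_split ν).map_eq,
      integral_add (f := fun z : E × (ℕ → E) => U z.1 ^ 2 + 2 * (U z.1 * Z n z.2))
        (i1.add (i3.const_mul 2)) i2, integral_add i1 (i3.const_mul 2),
      integral_const_mul, integral_prod_mul U (Z n), integral_fun_fst (fun e => U e ^ 2),
      integral_fun_snd (fun ω => Z n ω ^ 2)]
    simp
  have key' : ∫ ω, Z n ω ^ 2 ∂(seqLaw ν) ≤ _ := key.trans_eq e1
  rw [le_div_iff₀ (by linarith)]
  linarith

theorem integrable_maxSum_of_memLp {U : E → ℝ} (hUm : Measurable U) (hU : MemLp U 2 ν)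
    (hneg : ∫ e, U e ∂ν < 0) :
    Integrable (fun ω : ℕ → E => maxSum fun k => U (ω k)) (seqLaw ν) := by
  have hm := measurable_maxSum_comp hUm
  refine ⟨hm.aestronglyMeasurable, ?_⟩
  rw [hasFiniteIntegral_iff_ofReal (Eventually.of_forall fun ω => maxSum_nonneg _)]
  have hlim := ae_tendsto_sum_atBot hUm (hU.integrable one_le_two) hneg
  set b := (∫ e, U e ^ 2 ∂ν) / (2 * -∫ e, U e ∂ν)
  have hle : ∀ n, ∫⁻ ω, ENNReal.ofReal (lindley n (fun k => U (ω k)) 0) ∂(seqLaw ν) ≤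
      ENNReal.ofReal b := fun n => by
    rw [← ofReal_integral_eq_lintegral_ofReal ((memLp_lindley hUm hU n).integrable one_le_two)
      (Eventually.of_forall fun ω => lindley_nonneg n _ le_rfl)]
    exact ENNReal.ofReal_le_ofReal (integral_lindley_le hUm hU hneg n)
  -- Fatou's lemma along the iterates, which are eventually equal to their limit.
  calc ∫⁻ ω, ENNReal.ofReal (maxSum fun k => U (ω k)) ∂(seqLaw ν)
      ≤ ∫⁻ ω, liminf (fun n => ENNReal.ofReal (lindley n (fun k => U (ω k)) 0)) atTop
          ∂(seqLaw ν) := by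
        refine lintegral_mono_ae ?_
        filter_upwards [hlim] with ω hω
        refine le_of_eq (Tendsto.liminf_eq ?_).symm
        refine tendsto_const_nhds.congr' ?_
        filter_upwards [eventually_lindley_eq_maxSum hω le_rfl] with n hn
        rw [hn]
    _ ≤ liminf (fun n => ∫⁻ ω, ENNReal.ofReal (lindley n (fun k => U (ω k)) 0) ∂(seqLaw ν))
          atTop := lintegral_liminf_le fun n => (measurable_lindley_comp hUm n 0).ennreal_ofReal
    _ ≤ ENNReal.ofReal b := by
        refine liminf_le_of_le (by isBoundedDefault) fun c hc => ?_
        obtain ⟨n, hn⟩ := hc.exists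
        exact hn.trans (hle n)
    _ < ⊤ := ENNReal.ofReal_lt_top

/-- Inter-arrival times have only a first moment, so `U` need not be square integrable. Truncating
it below at `-K` restores the second moment and only increases the supremum, and for large `K` the
mean stays negative. -/
theorem integrable_maxSum {U : E → ℝ} (hUm : Measurable U) (hi : Integrable U ν)
    (hneg : ∫ e, U e ∂ν < 0) (hU : MemLp (fun e => max (U e) 0) 2 ν) :
    Integrable (fun ω : ℕ → E => maxSum fun k => U (ω k)) (seqLaw ν) := by
  have hlim : Tendsto (fun K : ℕ => ∫ e, max (U e) (-K) ∂ν) atTop (𝓝 (∫ e, U e ∂ν)) := by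
    refine tendsto_integral_of_dominated_convergence (fun e => |U e|)
      (fun K => (hUm.max measurable_const).aestronglyMeasurable) hi.abs
      (fun K => Eventually.of_forall fun e => ?_) (Eventually.of_forall fun e => ?_)
    · have : (0 : ℝ) ≤ K := K.cast_nonneg
      rw [Real.norm_eq_abs, abs_le]
      refine ⟨(neg_abs_le _).trans (le_max_left _ _), max_le (le_abs_self _) ?_⟩
      linarith [abs_nonneg (U e)]
    · refine tendsto_const_nhds.congr' ?_
      obtain ⟨N, hN⟩ := exists_nat_ge (-U e)
      filter_upwards [eventually_ge_atTop N] with n hn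
      have : (N : ℝ) ≤ n := by exact_mod_cast hn
      rw [max_eq_left (by linarith)]
  obtain ⟨K, hK⟩ := (hlim.eventually (gt_mem_nhds hneg)).exists
  have hVm : Measurable fun e => max (U e) (-K : ℝ) := hUm.max measurable_const
  have hV : MemLp (fun e => max (U e) (-K : ℝ)) 2 ν := by
    refine (hU.add (memLp_const (K : ℝ))).mono hVm.aestronglyMeasurable
      (Eventually.of_forall fun e => ?_)
    have h0 : (0 : ℝ) ≤ K := K.cast_nonneg
    have h1 : 0 ≤ max (U e) 0 := le_max_right _ _
    have h2 : U e ≤ max (U e) 0 := le_max_left _ _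
    simp only [Pi.add_apply, Real.norm_eq_abs]
    rw [abs_of_nonneg (a := max (U e) 0 + K) (by linarith), abs_le]
    exact ⟨by linarith [le_max_right (U e) (-K : ℝ)], max_le (by linarith) (by linarith)⟩
  refine (integrable_maxSum_of_memLp hVm hV hK).mono
    (measurable_maxSum_comp hUm).aestronglyMeasurable ?_
  filter_upwards [ae_tendsto_sum_atBot hVm (hV.integrable one_le_two) hK] with ω hω
  rw [Real.norm_of_nonneg (maxSum_nonneg _), Real.norm_of_nonneg (maxSum_nonneg _)]
  exact maxSum_mono (fun k => le_max_left _ _) hω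

/-! ### The pair of workloads -/

/-- The net input of station `m` between two successive arrivals. -/
noncomputable def netInput (m : Fin 2) (e : Action × (Fin 2 → ℝ≥0) × ℝ≥0) : ℝ :=
  (if e.1 = m.castSucc then (e.2.1 m : ℝ) else 0) - e.2.2

/-- The joint law of an action, the service requirements and an inter-arrival time. -/
noncomputable abbrev inputLaw (H : Measure ℝ≥0) (F : Fin 2 → Measure ℝ≥0) (p : Action → ℝ) :
    Measure (Action × (Fin 2 → ℝ≥0) × ℝ≥0) :=
  (actionLaw p).prod ((Measure.pi F).prod H)

theorem isProbabilityMeasure_actionLaw {p : Action → ℝ} (hp : p ∈ stdSimplex ℝ Action) :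
    IsProbabilityMeasure (actionLaw p) := by
  constructor
  simp only [actionLaw, Measure.coe_finsetSum, Finset.sum_apply, Measure.smul_apply, measure_univ,
    smul_eq_mul, mul_one]
  rw [← ENNReal.ofReal_sum_of_nonneg fun i _ => hp.1 i, hp.2, ENNReal.ofReal_one]

theorem measurable_netInput (m : Fin 2) : Measurable (netInput m) := by
  unfold netInput
  refine Measurable.sub (Measurable.ite ?_ (by fun_prop) measurable_const) (by fun_prop)
  exact measurable_fst (measurableSet_singleton (m.castSucc : Action))

theorem coe_nextState (x : State) (e : Action × (Fin 2 → ℝ≥0) × ℝ≥0) (m : Fin 2) :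
    (nextState x e.1 e.2.1 e.2.2 m : ℝ) = max 0 (netInput m e + x m) := by
  rw [nextState, NNReal.coe_sub_def, max_comm, netInput]
  congr 1
  split_ifs <;> push_cast <;> ring

theorem measurable_nextState :
    Measurable fun z : State × (Action × (Fin 2 → ℝ≥0) × ℝ≥0) =>
      nextState z.1 z.2.1 z.2.2.1 z.2.2.2 := by
  refine measurable_pi_lambda _ fun m => ?_
  unfold nextState
  refine Measurable.sub (Measurable.add (by fun_prop) (Measurable.ite ?_ (by fun_prop)
    measurable_const)) (by fun_prop)
  exact (measurable_fst.comp measurable_snd) (measurableSet_singleton (m.castSucc : Action))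

/-- The backward iterates of `nextState`, for a sequence of inputs starting with the most recent
one. -/
def backwardState : ℕ → State → (ℕ → Action × (Fin 2 → ℝ≥0) × ℝ≥0) → State
  | 0, x, _ => x
  | n + 1, x, ω =>
    nextState (backwardState n x fun k => ω (k + 1)) (ω 0).1 (ω 0).2.1 (ω 0).2.2

theorem coe_backwardState (n : ℕ) (x : State) (ω : ℕ → Action × (Fin 2 → ℝ≥0) × ℝ≥0)
    (m : Fin 2) :
    (backwardState n x ω m : ℝ) = lindley n (fun k => netInput m (ω k)) (x m) := by
  induction n generalizing ω with
  | zero => rfl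
  | succ n ih => rw [backwardState, coe_nextState, ih, lindley]

/-- The limit of the backward iterates. -/
noncomputable def limitState (ω : ℕ → Action × (Fin 2 → ℝ≥0) × ℝ≥0) : State :=
  fun m => (maxSum fun k => netInput m (ω k)).toNNReal

theorem coe_limitState (ω : ℕ → Action × (Fin 2 → ℝ≥0) × ℝ≥0) (m : Fin 2) :
    (limitState ω m : ℝ) = maxSum fun k => netInput m (ω k) :=
  Real.coe_toNNReal _ (maxSum_nonneg _)

theorem measurable_limitState : Measurable limitState :=
  measurable_pi_lambda _ fun m => (measurable_maxSum_comp (measurable_netInput m)).real_toNNReal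

section

variable {ν : Measure (Action × (Fin 2 → ℝ≥0) × ℝ≥0)} [IsProbabilityMeasure ν]

/-- The older inputs and the newest one are independent, so each backward step is one transition of
the chain. -/
theorem measurePreserving_backwardState {π : Measure State} [IsProbabilityMeasure π]
    (hπ : (π.prod ν).map (fun z => nextState z.1 z.2.1 z.2.2.1 z.2.2.2) = π) (n : ℕ) :
    MeasurePreserving (fun z : State × (ℕ → Action × (Fin 2 → ℝ≥0) × ℝ≥0) =>
      backwardState n z.1 z.2) (π.prod (seqLaw ν)) π := by
  induction n with
  | zero => exact measurePreserving_fst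
  | succ n ih =>
    have h1 : MeasurePreserving (fun z : State × (ℕ → Action × (Fin 2 → ℝ≥0) × ℝ≥0) =>
        (z.1, (fun k => z.2 (k + 1), z.2 0))) (π.prod (seqLaw ν)) (π.prod ((seqLaw ν).prod ν)) :=
      (MeasurePreserving.id π).prod (Measure.measurePreserving_swap.comp (measurePreserving_split ν))
    have h2 := (ih.prod (MeasurePreserving.id ν)).comp
      (((measurePreserving_prodAssoc π (seqLaw ν) ν).symm).comp h1)
    exact MeasurePreserving.comp ⟨measurable_nextState, hπ⟩ h2

theorem ae_tendsto_netInput (hd : ∀ m, Integrable (netInput m) ν ∧ ∫ e, netInput m e ∂ν < 0) :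
    ∀ᵐ ω ∂(seqLaw ν), ∀ m, Tendsto (fun n => ∑ k ∈ range n, netInput m (ω k)) atTop atBot :=
  ae_all_iff.2 fun m => ae_tendsto_sum_atBot (measurable_netInput m) (hd m).1 (hd m).2

/-- Almost surely the limit built from `ω` is one transition, with input `ω 0`, from the limit built
from the shifted sequence; the latter is independent of `ω 0` and has the same law. -/
theorem nextLaw_map_limitState
    (hd : ∀ m, Integrable (netInput m) ν ∧ ∫ e, netInput m e ∂ν < 0) :
    (((seqLaw ν).map limitState).prod ν).map (fun z => nextState z.1 z.2.1 z.2.2.1 z.2.2.2) =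
      (seqLaw ν).map limitState := by
  have h1 : MeasurePreserving limitState (seqLaw ν) ((seqLaw ν).map limitState) :=
    ⟨measurable_limitState, rfl⟩
  have : IsProbabilityMeasure ((seqLaw ν).map limitState) :=
    Measure.isProbabilityMeasure_map measurable_limitState.aemeasurable
  have h2 := (h1.prod (MeasurePreserving.id ν)).comp
    (Measure.measurePreserving_swap.comp (measurePreserving_split ν))
  rw [← h2.map_eq, Measure.map_map measurable_nextState h2.measurable]
  refine Measure.map_congr ?_
  filter_upwards [ae_tendsto_netInput hd] with ω hω
  funext m
  apply NNReal.coe_injective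
  rw [coe_limitState, maxSum_eq_max (hω m), ← coe_limitState]
  exact coe_nextState _ _ m

/-- Started from `π`, every backward iterate has law `π`, yet almost surely it eventually equals
`limitState`. Eventual equality makes the probabilities of every measurable set converge, so the
constant `π A` is the limit law's value. -/
theorem eq_map_limitState (hd : ∀ m, Integrable (netInput m) ν ∧ ∫ e, netInput m e ∂ν < 0)
    {π : Measure State} [IsProbabilityMeasure π]
    (hπ : (π.prod ν).map (fun z => nextState z.1 z.2.1 z.2.2.1 z.2.2.2) = π) :
    π = (seqLaw ν).map limitState := by
  set Ω := ℕ → Action × (Fin 2 → ℝ≥0) × ℝ≥0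
  have hsnd : MeasurePreserving (Prod.snd : State × Ω → Ω) (π.prod (seqLaw ν)) (seqLaw ν) :=
    measurePreserving_snd
  have hlim := hsnd.quasiMeasurePreserving.ae (ae_tendsto_netInput hd)
  ext A hA
  have hmA : MeasurableSet (limitState ⁻¹' A) := measurable_limitState hA
  have hev : ∀ᵐ z ∂(π.prod (seqLaw ν)), ∀ᶠ n in atTop,
      z ∈ (fun z : State × Ω => backwardState n z.1 z.2) ⁻¹' A ↔
        z ∈ (Prod.snd : State × Ω → Ω) ⁻¹' (limitState ⁻¹' A) := by
    filter_upwards [hlim] with z hz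
    have h : ∀ᶠ n in atTop, ∀ m, lindley n (fun k => netInput m (z.2 k)) (z.1 m) =
        maxSum fun k => netInput m (z.2 k) :=
      eventually_all.2 fun m => eventually_lindley_eq_maxSum (hz m) (NNReal.coe_nonneg _)
    filter_upwards [h] with n hn
    have h' : backwardState n z.1 z.2 = limitState z.2 := by
      funext m
      apply NNReal.coe_injective
      rw [coe_backwardState, hn, coe_limitState]
    rw [Set.mem_preimage, Set.mem_preimage, Set.mem_preimage, h']
  have ht := tendsto_measure_of_ae_tendsto_indicator_of_isFiniteMeasure (μ := π.prod (seqLaw ν))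
    atTop (hsnd.measurable hmA)
    (fun n => (measurePreserving_backwardState hπ n).measurable hA) hev
  rw [hsnd.measure_preimage hmA.nullMeasurableSet] at ht
  rw [Measure.map_apply measurable_limitState hA]
  refine tendsto_nhds_unique (tendsto_const_nhds.congr fun n => ?_) ht
  exact ((measurePreserving_backwardState hπ n).measure_preimage hA.nullMeasurableSet).symm

end

/-! ### Drift -/

/-- Stated for any input between `-A` and `Y - A`, so as to serve the actual input, its thinned copy
and the dominating input in which everyone joins. -/
theorem drift_of_le {E : Type*} [MeasurableSpace E] {ν : Measure E} [IsProbabilityMeasure ν]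
    {G H : Measure ℝ≥0} {Y A : E → ℝ≥0} (hY : MeasurePreserving Y ν G)
    (hA : MeasurePreserving A ν H) {U : E → ℝ} (hU : Measurable U)
    (hlow : ∀ e, -(A e : ℝ) ≤ U e) (hupp : ∀ e, U e ≤ Y e - A e)
    (hH : Integrable (fun a : ℝ≥0 => (a : ℝ)) H) (hG : Integrable (fun y : ℝ≥0 => (y : ℝ) ^ 2) G)
    (hstab : ∫ y, (y : ℝ) ∂G < ∫ a, (a : ℝ) ∂H) :
    Integrable U ν ∧ ∫ e, U e ∂ν < 0 ∧ MemLp (fun e => max (U e) 0) 2 ν := by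
  have hG2 : MemLp (fun y : ℝ≥0 => (y : ℝ)) 2 G :=
    (memLp_two_iff_integrable_sq NNReal.continuous_coe.aestronglyMeasurable).2 hG
  have hY2 : MemLp (fun e => (Y e : ℝ)) 2 ν := hG2.comp_measurePreserving hY
  have hYi : Integrable (fun e => (Y e : ℝ)) ν := hY2.integrable one_le_two
  have hAi : Integrable (fun e => (A e : ℝ)) ν := hA.integrable_comp_of_integrable hH
  have hUi : Integrable U ν := by
    refine (hYi.add hAi).mono hU.aestronglyMeasurable (Eventually.of_forall fun e => ?_)
    have h1 := (Y e).coe_nonneg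
    have h2 := (A e).coe_nonneg
    rw [Pi.add_apply, Real.norm_eq_abs, Real.norm_of_nonneg (by positivity), abs_le]
    constructor <;> linarith [hlow e, hupp e]
  refine ⟨hUi, ?_, ?_⟩
  · have h1 : ∫ e, (Y e : ℝ) ∂ν = ∫ y, (y : ℝ) ∂G := by
      rw [← hY.map_eq, integral_map hY.measurable.aemeasurable
        NNReal.continuous_coe.aestronglyMeasurable]
    have h2 : ∫ e, (A e : ℝ) ∂ν = ∫ a, (a : ℝ) ∂H := by
      rw [← hA.map_eq, integral_map hA.measurable.aemeasurable
        NNReal.continuous_coe.aestronglyMeasurable]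
    have h3 := integral_mono hUi (hYi.sub hAi) hupp
    simp only [Pi.sub_apply] at h3
    rw [integral_sub hYi hAi, h1, h2] at h3
    linarith
  · refine hY2.mono (hU.max measurable_const).aestronglyMeasurable (Eventually.of_forall fun e => ?_)
    rw [Real.norm_of_nonneg (le_max_right _ _), Real.norm_of_nonneg (Y e).coe_nonneg]
    exact max_le ((hupp e).trans (by linarith [(A e).coe_nonneg])) (Y e).coe_nonneg

/-! ### The steady state of a strategy. -/

section

variable (H : Measure ℝ≥0) [IsProbabilityMeasure H]
  (F : Fin 2 → Measure ℝ≥0) [∀ m, IsProbabilityMeasure (F m)] (p : Action → ℝ)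

/-- The steady state induced by a strategy. -/
noncomputable def steadyState : Measure State := (seqLaw (inputLaw H F p)).map limitState

variable {H F p}

variable [IsProbabilityMeasure (actionLaw p)]

theorem measurePreserving_service (m : Fin 2) :
    MeasurePreserving (fun e : Action × (Fin 2 → ℝ≥0) × ℝ≥0 => e.2.1 m) (inputLaw H F p) (F m) :=
  (measurePreserving_eval F m).comp (measurePreserving_fst.comp measurePreserving_snd)

theorem measurePreserving_interarrival :
    MeasurePreserving (fun e : Action × (Fin 2 → ℝ≥0) × ℝ≥0 => e.2.2) (inputLaw H F p) H :=
  measurePreserving_snd.comp measurePreserving_snd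

theorem netInput_drift (hH : Integrable (fun a : ℝ≥0 => (a : ℝ)) H)
    (hF : ∀ m, Integrable (fun y : ℝ≥0 => (y : ℝ) ^ 2) (F m))
    (hstab : ∀ m, ∫ y, (y : ℝ) ∂(F m) < ∫ a, (a : ℝ) ∂H) (m : Fin 2) :
    Integrable (netInput m) (inputLaw H F p) ∧ ∫ e, netInput m e ∂(inputLaw H F p) < 0 ∧
      MemLp (fun e => max (netInput m e) 0) 2 (inputLaw H F p) := by
  refine drift_of_le (measurePreserving_service m) measurePreserving_interarrival
    (measurable_netInput m) (fun e => ?_) (fun e => ?_) hH (hF m) (hstab m)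
  all_goals
    unfold netInput
    split_ifs <;> linarith [(e.2.1 m).coe_nonneg]

theorem isStationary_steadyState (hH : Integrable (fun a : ℝ≥0 => (a : ℝ)) H)
    (hF : ∀ m, Integrable (fun y : ℝ≥0 => (y : ℝ) ^ 2) (F m))
    (hstab : ∀ m, ∫ y, (y : ℝ) ∂(F m) < ∫ a, (a : ℝ) ∂H) :
    IsStationary H F p (steadyState H F p) :=
  ⟨Measure.isProbabilityMeasure_map measurable_limitState.aemeasurable,
    nextLaw_map_limitState fun m =>
      ⟨(netInput_drift hH hF hstab m).1, (netInput_drift hH hF hstab m).2.1⟩⟩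

theorem IsStationary.eq_steadyState (hH : Integrable (fun a : ℝ≥0 => (a : ℝ)) H)
    (hF : ∀ m, Integrable (fun y : ℝ≥0 => (y : ℝ) ^ 2) (F m))
    (hstab : ∀ m, ∫ y, (y : ℝ) ∂(F m) < ∫ a, (a : ℝ) ∂H) {π : Measure State}
    (hπ : IsStationary H F p π) : π = steadyState H F p := by
  have := hπ.1
  exact eq_map_limitState (fun m =>
    ⟨(netInput_drift hH hF hstab m).1, (netInput_drift hH hF hstab m).2.1⟩) hπ.2

theorem integrable_steadyState (hH : Integrable (fun a : ℝ≥0 => (a : ℝ)) H)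
    (hF : ∀ m, Integrable (fun y : ℝ≥0 => (y : ℝ) ^ 2) (F m))
    (hstab : ∀ m, ∫ y, (y : ℝ) ∂(F m) < ∫ a, (a : ℝ) ∂H) (m : Fin 2) :
    Integrable (fun x : State => (x m : ℝ)) (steadyState H F p) := by
  obtain ⟨h1, h2, h3⟩ := netInput_drift (p := p) hH hF hstab m
  have hmp : MeasurePreserving limitState (seqLaw (inputLaw H F p)) (steadyState H F p) :=
    ⟨measurable_limitState, rfl⟩
  rw [← hmp.integrable_comp (by fun_prop : Measurable fun x : State => (x m : ℝ)).aestronglyMeasurable]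
  refine (integrable_maxSum (measurable_netInput m) h1 h2 h3).congr ?_
  exact Eventually.of_forall fun ω => (coe_limitState ω m).symm

omit [IsProbabilityMeasure H] [∀ m, IsProbabilityMeasure (F m)] [IsProbabilityMeasure (actionLaw p)] in
theorem integral_steadyState (m : Fin 2) :
    ∫ x, (x m : ℝ) ∂(steadyState H F p) =
      ∫ ω, (maxSum fun k => netInput m (ω k)) ∂(seqLaw (inputLaw H F p)) := by
  rw [steadyState, integral_map measurable_limitState.aemeasurable
    (by fun_prop : Measurable fun x : State => (x m : ℝ)).aestronglyMeasurable]
  simp only [coe_limitState]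

end

/-! ### The mean workload at a single station -/

/-- The uniform law on the unit interval. -/
noncomputable abbrev uniformLaw : Measure ℝ := volume.restrict (Set.Icc 0 1)

instance isProbabilityMeasure_uniformLaw : IsProbabilityMeasure uniformLaw :=
  ⟨by simp⟩

/-- The joint law of a uniform variable, a service requirement and an inter-arrival time. -/
noncomputable abbrev queueLaw (G H : Measure ℝ≥0) : Measure (ℝ × ℝ≥0 × ℝ≥0) :=
  uniformLaw.prod (G.prod H)

/-- The net input of a station that a customer joins when the uniform variable is at most `q`. -/
noncomputable def thinnedInput (q : ℝ) (e : ℝ × ℝ≥0 × ℝ≥0) : ℝ :=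
  (if e.1 ≤ q then (e.2.1 : ℝ) else 0) - e.2.2

/-- The mean stationary workload of a station that customers join with probability `q`. -/
noncomputable def meanWorkload (G H : Measure ℝ≥0) (q : ℝ) : ℝ :=
  ∫ ω, (maxSum fun k => thinnedInput q (ω k)) ∂(seqLaw (queueLaw G H))

theorem measurable_thinnedInput (q : ℝ) : Measurable (thinnedInput q) := by
  unfold thinnedInput
  exact Measurable.sub (Measurable.ite (measurable_fst measurableSet_Iic) (by fun_prop)
    measurable_const) (by fun_prop)

/-- The same uniform variable serves all `q`, so comparisons between join probabilities are
pathwise. -/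
theorem thinnedInput_mono {q q' : ℝ} (h : q ≤ q') (e : ℝ × ℝ≥0 × ℝ≥0) :
    thinnedInput q e ≤ thinnedInput q' e := by
  have := e.2.1.coe_nonneg
  unfold thinnedInput
  split_ifs <;> linarith

theorem thinnedInput_le (q : ℝ) (e : ℝ × ℝ≥0 × ℝ≥0) : thinnedInput q e ≤ e.2.1 - e.2.2 := by
  have := e.2.1.coe_nonneg
  unfold thinnedInput
  split_ifs <;> linarith

theorem uniformLaw_Iic {q : ℝ} (hq : q ≤ 1) : uniformLaw (Set.Iic q) = ENNReal.ofReal q := by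
  have : Set.Iic q ∩ Set.Icc (0 : ℝ) 1 = Set.Icc 0 q := by
    ext x
    simp only [Set.mem_inter_iff, Set.mem_Iic, Set.mem_Icc]
    constructor
    · tauto
    · rintro ⟨h0, h1⟩
      exact ⟨h1, h0, h1.trans hq⟩
  rw [Measure.restrict_apply measurableSet_Iic, this, Real.volume_Icc, sub_zero]

theorem actionLaw_singleton (p : Action → ℝ) (i : Action) :
    actionLaw p {i} = ENNReal.ofReal (p i) := by
  simp only [actionLaw, Measure.coe_finsetSum, Finset.sum_apply, Measure.smul_apply, smul_eq_mul,
    Measure.dirac_apply' _ (measurableSet_singleton i)]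
  rw [Finset.sum_eq_single i]
  · simp
  · intro j _ hj
    simp [hj]
  · simp

theorem map_bool_eq {α β : Type*} [MeasurableSpace α] [MeasurableSpace β] {μ : Measure α}
    {ν : Measure β} [IsProbabilityMeasure μ] [IsProbabilityMeasure ν] {f : α → Bool} {g : β → Bool}
    (hf : Measurable f) (hg : Measurable g) (h : μ (f ⁻¹' {true}) = ν (g ⁻¹' {true})) :
    μ.map f = ν.map g := by
  have := Measure.isProbabilityMeasure_map (μ := μ) hf.aemeasurable
  have := Measure.isProbabilityMeasure_map (μ := ν) hg.aemeasurable
  have h1 : μ.map f {true} = ν.map g {true} := by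
    rw [Measure.map_apply hf (measurableSet_singleton _),
      Measure.map_apply hg (measurableSet_singleton _), h]
  refine Measure.ext_of_singleton fun b => ?_
  cases b with
  | true => exact h1
  | false =>
    have hc : ({false} : Set Bool) = {true}ᶜ := by ext b; cases b <;> simp
    rw [hc, prob_compl_eq_one_sub (measurableSet_singleton _),
      prob_compl_eq_one_sub (measurableSet_singleton _), h1]

section

variable {H : Measure ℝ≥0} [IsProbabilityMeasure H]

/-- Both inputs are the same function `κ` of a Bernoulli joining flag, a service time and an
inter-arrival time, independent of each other; only the source of the flag differs. -/
theorem map_netInput {F : Fin 2 → Measure ℝ≥0} [∀ m, IsProbabilityMeasure (F m)]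
    {p : Action → ℝ} (hp : p ∈ stdSimplex ℝ Action) (m : Fin 2) :
    (inputLaw H F p).map (netInput m) =
      (queueLaw (F m) H).map (thinnedInput (p m.castSucc)) := by
  have := isProbabilityMeasure_actionLaw hp
  set κ : Bool × ℝ≥0 × ℝ≥0 → ℝ := fun b => (if b.1 = true then (b.2.1 : ℝ) else 0) - b.2.2
  have hκ : Measurable κ := Measurable.sub (Measurable.ite
    (measurable_fst (measurableSet_singleton true)) (by fun_prop) measurable_const) (by fun_prop)
  have hf : Measurable fun i : Action => decide (i = m.castSucc) := measurable_of_finite _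
  have hg : Measurable fun u : ℝ => decide (u ≤ p m.castSucc) :=
    measurable_to_bool (by
      convert (measurableSet_Iic : MeasurableSet (Set.Iic (p m.castSucc))) using 1
      ext; simp)
  have hle : p m.castSucc ≤ 1 := by
    rw [← hp.2]
    exact Finset.single_le_sum (fun i _ => hp.1 i) (Finset.mem_univ _)
  have hb : (actionLaw p).map (fun i : Action => decide (i = m.castSucc)) =
      uniformLaw.map fun u : ℝ => decide (u ≤ p m.castSucc) := by
    refine map_bool_eq hf hg ?_
    have e1 : (fun i : Action => decide (i = m.castSucc)) ⁻¹' {true} = {m.castSucc} := by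
      ext; simp
    have e2 : (fun u : ℝ => decide (u ≤ p m.castSucc)) ⁻¹' {true} = Set.Iic (p m.castSucc) := by
      ext; simp
    rw [e1, e2, actionLaw_singleton, uniformLaw_Iic hle]
  have h1 : MeasurePreserving (fun e : Action × (Fin 2 → ℝ≥0) × ℝ≥0 =>
      (decide (e.1 = m.castSucc), (e.2.1 m, e.2.2))) (inputLaw H F p)
      (((actionLaw p).map fun i : Action => decide (i = m.castSucc)).prod ((F m).prod H)) :=
    (show MeasurePreserving _ _ _ from ⟨hf, rfl⟩).prod
      ((measurePreserving_eval F m).prod (MeasurePreserving.id H))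
  have h2 : MeasurePreserving (fun e : ℝ × ℝ≥0 × ℝ≥0 =>
      (decide (e.1 ≤ p m.castSucc), e.2)) (queueLaw (F m) H)
      (((actionLaw p).map fun i : Action => decide (i = m.castSucc)).prod ((F m).prod H)) :=
    (show MeasurePreserving _ _ _ from ⟨hg, hb.symm⟩).prod (MeasurePreserving.id _)
  have e1 : netInput m = κ ∘ fun e : Action × (Fin 2 → ℝ≥0) × ℝ≥0 =>
      (decide (e.1 = m.castSucc), (e.2.1 m, e.2.2)) := by
    funext e
    simp [netInput, κ]
  have e2 : thinnedInput (p m.castSucc) = κ ∘ fun e : ℝ × ℝ≥0 × ℝ≥0 =>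
      (decide (e.1 ≤ p m.castSucc), e.2) := by
    funext e
    simp [thinnedInput, κ]
  rw [e1, e2, ← Measure.map_map hκ h1.measurable, ← Measure.map_map hκ h2.measurable,
    h1.map_eq, h2.map_eq]

theorem integral_maxSum_comp {E : Type*} [MeasurableSpace E] {ν : Measure E}
    [IsProbabilityMeasure ν] {U : E → ℝ} (hU : Measurable U) :
    ∫ ω, (maxSum fun k => U (ω k)) ∂(seqLaw ν) = ∫ u, maxSum u ∂(seqLaw (ν.map U)) := by
  have hm : Measurable fun (ω : ℕ → E) k => U (ω k) :=
    measurable_pi_lambda _ fun k => hU.comp (measurable_pi_apply k)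
  rw [seqLaw, seqLaw, ← Measure.infinitePi_map_pi (fun _ : ℕ => ν) (f := fun _ => U) fun _ => hU,
    integral_map hm.aemeasurable measurable_maxSum.aestronglyMeasurable]

theorem integral_steadyState_eq_meanWorkload {F : Fin 2 → Measure ℝ≥0}
    [∀ m, IsProbabilityMeasure (F m)] {p : Action → ℝ} (hp : p ∈ stdSimplex ℝ Action) (m : Fin 2) :
    ∫ x, (x m : ℝ) ∂(steadyState H F p) = meanWorkload (F m) H (p m.castSucc) := by
  have := isProbabilityMeasure_actionLaw hp
  rw [integral_steadyState, meanWorkload, integral_maxSum_comp (measurable_netInput m),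
    integral_maxSum_comp (measurable_thinnedInput _), map_netInput hp]

variable {G : Measure ℝ≥0} [IsProbabilityMeasure G]

theorem thinnedInput_drift (hH : Integrable (fun a : ℝ≥0 => (a : ℝ)) H)
    (hG : Integrable (fun y : ℝ≥0 => (y : ℝ) ^ 2) G)
    (hstab : ∫ y, (y : ℝ) ∂G < ∫ a, (a : ℝ) ∂H) (q : ℝ) :
    Integrable (thinnedInput q) (queueLaw G H) ∧ ∫ e, thinnedInput q e ∂(queueLaw G H) < 0 ∧
      MemLp (fun e => max (thinnedInput q e) 0) 2 (queueLaw G H) := by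
  refine drift_of_le (measurePreserving_fst.comp measurePreserving_snd)
    (measurePreserving_snd.comp measurePreserving_snd)
    (measurable_thinnedInput q) (fun e => ?_) (thinnedInput_le q) hH hG hstab
  have := e.2.1.coe_nonneg
  unfold thinnedInput
  simp only [Function.comp_apply]
  split_ifs <;> linarith

/-- Dominated convergence, with the workload when everyone joins as the bound. That extreme walk
also supplies an `N`, the same for all `q`, beyond which inputs are irrelevant; almost surely no
uniform variable equals `q₀`, so the first `N` inputs are constant in `q` near `q₀`. -/
theorem continuous_meanWorkload (hH : Integrable (fun a : ℝ≥0 => (a : ℝ)) H)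
    (hG : Integrable (fun y : ℝ≥0 => (y : ℝ) ^ 2) G)
    (hstab : ∫ y, (y : ℝ) ∂G < ∫ a, (a : ℝ) ∂H) : Continuous (meanWorkload G H) := by
  have hUm : Measurable fun e : ℝ × ℝ≥0 × ℝ≥0 => (e.2.1 : ℝ) - e.2.2 := by fun_prop
  obtain ⟨h1, h2, h3⟩ := drift_of_le (ν := queueLaw G H)
    (measurePreserving_fst.comp measurePreserving_snd)
    (measurePreserving_snd.comp measurePreserving_snd) hUm
    (fun e => by simp) (fun e => le_rfl) hH hG hstab
  have hlim := ae_tendsto_sum_atBot hUm h1 h2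
  refine continuous_iff_continuousAt.2 fun q₀ => ?_
  have hne : ∀ᵐ ω ∂(seqLaw (queueLaw G H)), ∀ k, (ω k).1 ≠ q₀ := by
    refine ae_all_iff.2 fun k => ?_
    have h0 : ∀ᵐ u ∂uniformLaw, u ≠ q₀ := ae_restrict_of_ae (Measure.ae_ne volume q₀)
    exact (measurePreserving_fst.comp (measurePreserving_eval_infinitePi
      (fun _ : ℕ => queueLaw G H) k)).quasiMeasurePreserving.ae h0
  refine tendsto_integral_filter_of_dominated_convergence
    (fun ω => maxSum fun k => ((ω k).2.1 : ℝ) - (ω k).2.2)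
    (Eventually.of_forall fun q =>
      (measurable_maxSum_comp (measurable_thinnedInput q)).aestronglyMeasurable)
    (Eventually.of_forall fun q => ?_) (integrable_maxSum hUm h1 h2 h3) ?_
  · filter_upwards [hlim] with ω hω
    rw [Real.norm_of_nonneg (maxSum_nonneg _)]
    exact maxSum_mono (fun k => thinnedInput_le q (ω k)) hω
  · filter_upwards [hlim, hne] with ω hω hne
    obtain ⟨N, hN⟩ := eventually_sum_range_nonpos hω
    have hlin : ∀ q, lindley N (fun k => thinnedInput q (ω k)) 0 =
        maxSum fun k => thinnedInput q (ω k) := fun q => by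
      have h : ∀ k, N ≤ k → ∑ i ∈ range k, thinnedInput q (ω i) ≤ 0 := fun k hk =>
        (sum_le_sum fun i _ => thinnedInput_le q (ω i)).trans (hN k hk)
      exact lindley_eq_maxSum le_rfl h (by simpa using h N le_rfl)
    have hev : ∀ᶠ q in 𝓝 q₀, ∀ k ∈ range N, thinnedInput q (ω k) = thinnedInput q₀ (ω k) := by
      refine (eventually_all_finset _).2 fun k _ => ?_
      rcases lt_or_gt_of_ne (hne k) with h | h
      · filter_upwards [lt_mem_nhds h] with q hq
        simp [thinnedInput, hq.le, h.le]
      · filter_upwards [gt_mem_nhds h] with q hq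
        simp [thinnedInput, hq.not_ge, h.not_ge]
    refine tendsto_const_nhds.congr' ?_
    filter_upwards [hev] with q hq
    rw [← hlin, ← hlin]
    exact lindley_congr (fun k hk => (hq k (mem_range.2 hk)).symm) 0

/-- The pathwise inequality is strict when the most recent customer joins under `q'` but not under
`q` and brings a service longer than the next inter-arrival time, an event of positive probability.
-/
theorem strictMonoOn_meanWorkload (hH : Integrable (fun a : ℝ≥0 => (a : ℝ)) H)
    (hG : Integrable (fun y : ℝ≥0 => (y : ℝ) ^ 2) G)
    (hstab : ∫ y, (y : ℝ) ∂G < ∫ a, (a : ℝ) ∂H)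
    (hpos : 0 < (H.prod G) {z : ℝ≥0 × ℝ≥0 | z.1 < z.2}) :
    StrictMonoOn (meanWorkload G H) (Set.Icc 0 1) := by
  intro q hq q' hq' hlt
  have hint : ∀ q, Integrable (fun ω : ℕ → ℝ × ℝ≥0 × ℝ≥0 =>
      maxSum fun k => thinnedInput q (ω k)) (seqLaw (queueLaw G H)) := fun q => by
    obtain ⟨h1, h2, h3⟩ := thinnedInput_drift hH hG hstab q
    exact integrable_maxSum (measurable_thinnedInput q) h1 h2 h3
  have hlim : ∀ q, ∀ᵐ ω ∂(seqLaw (queueLaw G H)),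
      Tendsto (fun n => ∑ k ∈ range n, thinnedInput q (ω k)) atTop atBot := fun q => by
    obtain ⟨h1, h2, -⟩ := thinnedInput_drift hH hG hstab q
    exact ae_tendsto_sum_atBot (measurable_thinnedInput q) h1 h2
  rw [← sub_pos, meanWorkload, meanWorkload, ← integral_sub (hint q') (hint q)]
  refine (integral_pos_iff_support_of_nonneg_ae ?_ ((hint q').sub (hint q))).2 ?_
  · filter_upwards [hlim q'] with ω hω
    exact sub_nonneg.2 (maxSum_mono (fun k => thinnedInput_mono hlt.le (ω k)) hω)
  · set B : Set (ℝ × ℝ≥0 × ℝ≥0) := Set.Ioc q q' ×ˢ {w | w.2 < w.1}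
    have hBm : MeasurableSet B := measurableSet_Ioc.prod
      (measurableSet_lt measurable_snd measurable_fst)
    have hB : 0 < queueLaw G H B := by
      rw [Measure.prod_prod]
      refine ENNReal.mul_pos (ne_of_gt ?_) (ne_of_gt ?_)
      · have : Set.Ioc q q' ∩ Set.Icc (0 : ℝ) 1 = Set.Ioc q q' := Set.inter_eq_left.2 fun x hx =>
          ⟨hq.1.trans hx.1.le, hx.2.trans hq'.2⟩
        rw [Measure.restrict_apply measurableSet_Ioc, this, Real.volume_Ioc]
        exact ENNReal.ofReal_pos.2 (sub_pos.2 hlt)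
      · have hsw := (Measure.measurePreserving_swap (μ := G) (ν := H)).measure_preimage
          (measurableSet_lt measurable_fst measurable_snd).nullMeasurableSet
        rw [← hsw] at hpos
        exact hpos
    have hmp := measurePreserving_eval_infinitePi (fun _ : ℕ => queueLaw G H) 0
    rw [← hmp.measure_preimage hBm.nullMeasurableSet] at hB
    refine hB.trans_le (measure_mono_ae ?_)
    filter_upwards [hlim q, hlim q'] with ω hω hω' hmem
    obtain ⟨⟨hu, hu'⟩, hya⟩ := hmem
    have hya' : ((ω 0).2.2 : ℝ) < (ω 0).2.1 := hya
    have ha := (ω 0).2.2.coe_nonneg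
    have h1 := maxSum_mono (fun k => thinnedInput_mono hlt.le (ω (k + 1)))
      (tendsto_sum_range_shift hω')
    have h0 := maxSum_nonneg fun k => thinnedInput q (ω (k + 1))
    have e : thinnedInput q (ω 0) = -(ω 0).2.2 := by
      simp only [Function.eval] at hu
      simp [thinnedInput, not_le.2 hu]
    have e' : thinnedInput q' (ω 0) = (ω 0).2.1 - (ω 0).2.2 := by
      simp only [Function.eval] at hu'
      simp [thinnedInput, hu']
    refine (sub_pos.2 (?_ : maxSum _ < maxSum _)).ne'
    rw [maxSum_eq_max hω, maxSum_eq_max hω', e, e']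
    exact lt_max_of_lt_right (max_lt (by linarith) (by linarith))

end

/-! ### The congestion game -/

/-- The payoffs of the actions when the value of a station depends on its own join probability. -/
def payoff (g : Fin 2 → ℝ → ℝ) (p : Action → ℝ) : Action → ℝ := ![g 0 (p 0), g 1 (p 1), 0]

/-- Every action that `p` uses maximizes the payoff. -/
def IsEquilibrium (g : Fin 2 → ℝ → ℝ) (p : Action → ℝ) : Prop :=
  p ∈ stdSimplex ℝ Action ∧ ∀ i, 0 < p i → ∀ j, payoff g p j ≤ payoff g p i

/-- The equilibrium of the game without balking: a corner, or else the difference of the two values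
changes sign. -/
theorem exists_split_equilibrium {f g : ℝ → ℝ} (hf : Continuous f) (hg : Continuous g) :
    ∃ q ∈ Set.Icc (0 : ℝ) 1, (0 < q → g (1 - q) ≤ f q) ∧ (q < 1 → f q ≤ g (1 - q)) := by
  by_cases h0 : f 0 ≤ g (1 - 0)
  · exact ⟨0, by simp, fun h => absurd h (lt_irrefl _), fun _ => h0⟩
  by_cases h1 : g (1 - 1) ≤ f 1
  · exact ⟨1, by simp, fun _ => h1, fun h => absurd h (lt_irrefl _)⟩
  have hc : ContinuousOn (fun q => f q - g (1 - q)) (Set.Icc 0 1) := by fun_prop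
  obtain ⟨q, hq, hq0⟩ := intermediate_value_Icc' zero_le_one hc
    (show (0 : ℝ) ∈ _ from ⟨by linarith [not_le.1 h1], by linarith [not_le.1 h0]⟩)
  have hq0' : f q = g (1 - q) := sub_eq_zero.1 hq0
  exact ⟨q, hq, fun _ => hq0'.ge, fun _ => hq0'.le⟩

theorem exists_thinning {g : ℝ → ℝ} (hg : Continuous g) {q : ℝ} (hq : 0 ≤ q) (hgq : g q ≤ 0) :
    ∃ r ∈ Set.Icc 0 q, g r ≤ 0 ∧ (0 < r → g r = 0) := by
  by_cases h0 : g 0 ≤ 0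
  · exact ⟨0, ⟨le_rfl, hq⟩, h0, fun h => absurd h (lt_irrefl _)⟩
  obtain ⟨r, hr, hr0⟩ := intermediate_value_Icc' hq hg.continuousOn
    (show (0 : ℝ) ∈ _ from ⟨hgq, (not_le.1 h0).le⟩)
  exact ⟨r, hr, hr0.le, fun _ => hr0⟩

theorem exists_isEquilibrium {g : Fin 2 → ℝ → ℝ} (hg : ∀ m, Continuous (g m)) :
    ∃ p, IsEquilibrium g p := by
  obtain ⟨q, ⟨hq0, hq1⟩, hl, hr⟩ := exists_split_equilibrium (hg 0) (hg 1)
  -- If neither station is worth joining at the split, each probability is lowered until the value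
  -- is zero or nobody joins, and the freed mass balks. Otherwise the split itself is an
  -- equilibrium.
  by_cases hneg : g 0 q ≤ 0 ∧ g 1 (1 - q) ≤ 0
  · obtain ⟨r, ⟨hr0, hr1⟩, hr2, hr3⟩ := exists_thinning (hg 0) hq0 hneg.1
    obtain ⟨s, ⟨hs0, hs1⟩, hs2, hs3⟩ := exists_thinning (hg 1) (sub_nonneg.2 hq1) hneg.2
    refine ⟨![r, s, 1 - r - s], ⟨fun i => ?_, ?_⟩, fun i hi j => ?_⟩
    · fin_cases i
      exacts [hr0, hs0, show 0 ≤ 1 - r - s by linarith]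
    · simp [Fin.sum_univ_three]
    · have h1 : payoff g ![r, s, 1 - r - s] j ≤ 0 := by
        fin_cases j
        exacts [hr2, hs2, le_rfl]
      have h2 : payoff g ![r, s, 1 - r - s] i = 0 := by
        fin_cases i
        exacts [hr3 hi, hs3 hi, rfl]
      rwa [h2]
  · refine ⟨![q, 1 - q, 0], ⟨fun i => ?_, ?_⟩, fun i hi j => ?_⟩
    · fin_cases i
      exacts [hq0, sub_nonneg.2 hq1, le_rfl]
    · simp [Fin.sum_univ_three]
    -- A used station is at least as good as the other one, so one positive value puts it above
    -- balking.
    · have hpos : 0 < g 0 q ∨ 0 < g 1 (1 - q) := by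
        by_contra! h
        exact hneg h
      fin_cases i
      · have h1 := hl hi
        have h2 : 0 ≤ g 0 q := by rcases hpos with h | h <;> linarith
        fin_cases j
        exacts [le_rfl, h1, h2]
      · have h1 := hr (sub_pos.1 hi)
        have h2 : 0 ≤ g 1 (1 - q) := by rcases hpos with h | h <;> linarith
        fin_cases j
        exacts [h1, le_rfl, h2]
      · exact absurd hi (lt_irrefl _)

/-- The variational form of equilibrium: with payoffs frozen at `p`, no mixed deviation does better.
-/
theorem IsEquilibrium.sum_mul_payoff_le {g : Fin 2 → ℝ → ℝ} {p p' : Action → ℝ}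
    (hp : IsEquilibrium g p) (hp' : p' ∈ stdSimplex ℝ Action) :
    ∑ i, p' i * payoff g p i ≤ ∑ i, p i * payoff g p i := by
  have h : ∀ j, payoff g p j ≤ ∑ i, p i * payoff g p i := fun j => by
    calc payoff g p j = ∑ i, p i * payoff g p j := by rw [← sum_mul, hp.1.2, one_mul]
      _ ≤ _ := sum_le_sum fun i _ => by
        rcases (hp.1.1 i).eq_or_lt with h | h
        · rw [← h, zero_mul, zero_mul]
        · exact mul_le_mul_of_nonneg_left (hp.2 i h j) h.le
  calc ∑ i, p' i * payoff g p i ≤ ∑ i, p' i * ∑ k, p k * payoff g p k :=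
        sum_le_sum fun i _ => mul_le_mul_of_nonneg_left (h i) (hp'.1 i)
    _ = _ := by rw [← sum_mul, hp'.2, one_mul]

/-- Adding the two variational inequalities gives `0 ≤ ∑ m, (p m - p' m) * (g m (p m) - g m (p' m))`
over the stations, balking contributing nothing. Each term is nonpositive, and negative where the
probabilities differ. -/
theorem IsEquilibrium.eq {g : Fin 2 → ℝ → ℝ} (hg : ∀ m, StrictAntiOn (g m) (Set.Icc 0 1))
    {p p' : Action → ℝ} (hp : IsEquilibrium g p) (hp' : IsEquilibrium g p') : p = p' := by
  have hmem : ∀ {p : Action → ℝ}, p ∈ stdSimplex ℝ Action → ∀ i, p i ∈ Set.Icc (0 : ℝ) 1 :=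
    fun {p} h i => ⟨h.1 i, by rw [← h.2]; exact single_le_sum (fun j _ => h.1 j) (mem_univ i)⟩
  have hterm : ∀ (m : Fin 2) {x y : ℝ}, x ∈ Set.Icc (0 : ℝ) 1 → y ∈ Set.Icc (0 : ℝ) 1 → x ≠ y →
      (x - y) * (g m x - g m y) < 0 := fun m x y hx hy hxy => by
    rcases lt_or_gt_of_ne hxy with h | h
    · exact mul_neg_of_neg_of_pos (sub_neg.2 h) (sub_pos.2 (hg m hx hy h))
    · exact mul_neg_of_pos_of_neg (sub_pos.2 h) (sub_neg.2 (hg m hy hx h))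
  have hterm' : ∀ (m : Fin 2) {x y : ℝ}, x ∈ Set.Icc (0 : ℝ) 1 → y ∈ Set.Icc (0 : ℝ) 1 →
      (x - y) * (g m x - g m y) ≤ 0 := fun m x y hx hy => by
    rcases eq_or_ne x y with h | h
    · simp [h]
    · exact (hterm m hx hy h).le
  have h1 := hp.sum_mul_payoff_le hp'.1
  have h2 := hp'.sum_mul_payoff_le hp.1
  have s1 := hp.1.2
  have s2 := hp'.1.2
  simp only [Fin.sum_univ_three, payoff, Matrix.cons_val_zero, Matrix.cons_val_one,
    Matrix.cons_val] at h1 h2 s1 s2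
  have ha := hterm' 0 (hmem hp.1 0) (hmem hp'.1 0)
  have hb := hterm' 1 (hmem hp.1 1) (hmem hp'.1 1)
  have e0 : p 0 = p' 0 := by
    by_contra h
    have := hterm 0 (hmem hp.1 0) (hmem hp'.1 0) h
    linarith
  have e1 : p 1 = p' 1 := by
    by_contra h
    have := hterm 1 (hmem hp.1 1) (hmem hp'.1 1) h
    linarith
  funext i
  fin_cases i
  exacts [e0, e1, by change p 2 = p' 2; linarith]

/-! ### Expected utilities in the steady state -/

/-- The expected utility of joining a station that customers join with probability `q`. -/
noncomputable def stationValue (H : Measure ℝ≥0) (F : Fin 2 → Measure ℝ≥0) (R C : ℝ) (m : Fin 2)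
    (q : ℝ) : ℝ :=
  R - C * (meanWorkload (F m) H q + ∫ y, (y : ℝ) ∂(F m))

theorem utility_castSucc (R C : ℝ) (m : Fin 2) (x : State) (y : Fin 2 → ℝ≥0) :
    utility R C m.castSucc x y = R - C * ((x m : ℝ) + (y m : ℝ)) := by
  fin_cases m <;> rfl

section

variable {H : Measure ℝ≥0} [IsProbabilityMeasure H]
  {F : Fin 2 → Measure ℝ≥0} [∀ m, IsProbabilityMeasure (F m)]

theorem integrable_coe_of_sq {G : Measure ℝ≥0} [IsProbabilityMeasure G]
    (hG : Integrable (fun y : ℝ≥0 => (y : ℝ) ^ 2) G) : Integrable (fun y : ℝ≥0 => (y : ℝ)) G :=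
  ((memLp_two_iff_integrable_sq NNReal.continuous_coe.aestronglyMeasurable).2 hG).integrable
    one_le_two

theorem integrable_utility {π : Measure State} [IsProbabilityMeasure π]
    (hπ : ∀ m, Integrable (fun x : State => (x m : ℝ)) π)
    (hF : ∀ m, Integrable (fun y : ℝ≥0 => (y : ℝ)) (F m)) (R C : ℝ) (i : Action) :
    Integrable (fun z : State × (Fin 2 → ℝ≥0) => utility R C i z.1 z.2)
      (π.prod (Measure.pi F)) := by
  refine Fin.lastCases ?_ (fun m => ?_) i
  · exact integrable_zero _ _ _
  · simp only [utility_castSucc]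
    exact (integrable_const R).sub ((((hπ m).comp_fst _).add
      (((measurePreserving_eval F m).integrable_comp_of_integrable (hF m)).comp_snd _)).const_mul C)

theorem expectedUtility_castSucc {π : Measure State} [IsProbabilityMeasure π]
    (hπ : ∀ m, Integrable (fun x : State => (x m : ℝ)) π)
    (hF : ∀ m, Integrable (fun y : ℝ≥0 => (y : ℝ)) (F m)) (R C : ℝ) (m : Fin 2) :
    expectedUtility F R C π m.castSucc =
      R - C * (∫ x, (x m : ℝ) ∂π + ∫ y, (y : ℝ) ∂(F m)) := by
  have h1 : Integrable (fun z : State × (Fin 2 → ℝ≥0) => (z.1 m : ℝ)) (π.prod (Measure.pi F)) :=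
    (hπ m).comp_fst _
  have h2' : Integrable (fun y : Fin 2 → ℝ≥0 => (y m : ℝ)) (Measure.pi F) :=
    (measurePreserving_eval F m).integrable_comp_of_integrable (hF m)
  have h2 : Integrable (fun z : State × (Fin 2 → ℝ≥0) => (z.2 m : ℝ)) (π.prod (Measure.pi F)) :=
    h2'.comp_snd _
  have h3 : ∫ y, (y m : ℝ) ∂(Measure.pi F) = ∫ y, (y : ℝ) ∂(F m) := by
    have := integral_map (μ := Measure.pi F) (measurePreserving_eval F m).measurable.aemeasurable
      (f := fun y : ℝ≥0 => (y : ℝ)) NNReal.continuous_coe.aestronglyMeasurable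
    rw [(measurePreserving_eval F m).map_eq] at this
    exact this.symm
  simp only [expectedUtility, utility_castSucc]
  have h4 : Integrable (fun z : State × (Fin 2 → ℝ≥0) => C * ((z.1 m : ℝ) + (z.2 m : ℝ)))
      (π.prod (Measure.pi F)) := (h1.add h2).const_mul C
  rw [integral_sub (integrable_const R) h4, integral_const_mul,
    integral_add h1 h2, integral_fun_fst (fun x : State => (x m : ℝ)),
    integral_fun_snd (fun y : Fin 2 → ℝ≥0 => (y m : ℝ)), h3]
  simp

theorem expectedUtility_steadyState (hH : Integrable (fun a : ℝ≥0 => (a : ℝ)) H)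
    (hF : ∀ m, Integrable (fun y : ℝ≥0 => (y : ℝ) ^ 2) (F m))
    (hstab : ∀ m, ∫ y, (y : ℝ) ∂(F m) < ∫ a, (a : ℝ) ∂H) (R C : ℝ) {p : Action → ℝ}
    (hp : p ∈ stdSimplex ℝ Action) (i : Action) :
    expectedUtility F R C (steadyState H F p) i = payoff (stationValue H F R C) p i := by
  have := isProbabilityMeasure_actionLaw hp
  have := (isStationary_steadyState (p := p) hH hF hstab).1
  have h : ∀ m : Fin 2, expectedUtility F R C (steadyState H F p) m.castSucc =
      stationValue H F R C m (p m.castSucc) := fun m => by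
    rw [expectedUtility_castSucc (integrable_steadyState hH hF hstab)
      (fun m => integrable_coe_of_sq (hF m)), integral_steadyState_eq_meanWorkload hp, stationValue]
  fin_cases i
  · exact h 0
  · exact h 1
  · exact integral_zero _ _

/-- Uniqueness of the stationary law removes the choice of `π`, which reduces the queueing game to
the static one. -/
theorem isSymmetricNash_iff (hH : Integrable (fun a : ℝ≥0 => (a : ℝ)) H)
    (hF : ∀ m, Integrable (fun y : ℝ≥0 => (y : ℝ) ^ 2) (F m))
    (hstab : ∀ m, ∫ y, (y : ℝ) ∂(F m) < ∫ a, (a : ℝ) ∂H) (R C : ℝ) (p : Action → ℝ) :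
    IsSymmetricNash H F R C p ↔ IsEquilibrium (stationValue H F R C) p := by
  constructor
  · rintro ⟨hp, π, hπ, -, hmax⟩
    have := isProbabilityMeasure_actionLaw hp
    refine ⟨hp, fun i hi j => ?_⟩
    rw [← expectedUtility_steadyState hH hF hstab R C hp,
      ← expectedUtility_steadyState hH hF hstab R C hp, ← hπ.eq_steadyState hH hF hstab]
    exact hmax i hi j
  · rintro ⟨hp, hmax⟩
    have := isProbabilityMeasure_actionLaw hp
    have hπ := isStationary_steadyState (p := p) hH hF hstab
    have := hπ.1
    refine ⟨hp, steadyState H F p, hπ, integrable_utility (integrable_steadyState hH hF hstab)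
      (fun m => integrable_coe_of_sq (hF m)) R C, fun i hi j => ?_⟩
    rw [expectedUtility_steadyState hH hF hstab R C hp,
      expectedUtility_steadyState hH hF hstab R C hp]
    exact hmax i hi j

end

end ParallelQueues

/-! ### The main theorem. -/

theorem mainTheorem10
    -- inter-arrival law: continuous, with finite mean
    (H : MeasureTheory.Measure NNReal) [MeasureTheory.IsProbabilityMeasure H]
    (hcont : ∀ a, H {a} = 0)
    (hH : MeasureTheory.Integrable (fun a : NNReal => (a : ℝ)) H)
    -- service laws, with finite second moments
    (F : Fin 2 → MeasureTheory.Measure NNReal)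
    [∀ m, MeasureTheory.IsProbabilityMeasure (F m)]
    (hF : ∀ m, MeasureTheory.Integrable (fun y : NNReal => (y : ℝ) ^ 2) (F m))
    -- stability: the mean service times are smaller than the mean inter-arrival time
    (hstab : ∀ m, ∫ y, (y : ℝ) ∂(F m) < ∫ a, (a : ℝ) ∂H)
    (R C : ℝ) (hR : 0 < R) (hC : 0 < C) :
    -- every strategy induces a unique stationary distribution, and it has finite means
    (∀ p ∈ stdSimplex ℝ ParallelQueues.Action,
      ∃ π : MeasureTheory.Measure ParallelQueues.State,
        ParallelQueues.IsStationary H F p π ∧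
        (∀ m, MeasureTheory.Integrable (fun x : ParallelQueues.State => (x m : ℝ)) π) ∧
        ∀ π' : MeasureTheory.Measure ParallelQueues.State,
          ParallelQueues.IsStationary H F p π' → π' = π) ∧
    -- an equilibrium exists
    (∃ p, ParallelQueues.IsSymmetricNash H F R C p) ∧
    -- it is unique if at each station a service can outlast an inter-arrival time
    ((∀ m, 0 < (H.prod (F m)) {z : NNReal × NNReal | z.1 < z.2}) →
      ∃! p, ParallelQueues.IsSymmetricNash H F R C p) := by
  have hg : ∀ m, Continuous (ParallelQueues.stationValue H F R C m) := fun m =>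
    continuous_const.sub (continuous_const.mul
      ((ParallelQueues.continuous_meanWorkload hH (hF m) (hstab m)).add continuous_const))
  have hex : ∃ p, ParallelQueues.IsSymmetricNash H F R C p := by
    obtain ⟨p, hp⟩ := ParallelQueues.exists_isEquilibrium hg
    exact ⟨p, (ParallelQueues.isSymmetricNash_iff hH hF hstab R C p).2 hp⟩
  refine ⟨fun p hp => ?_, hex, fun hpos => ?_⟩
  · have := ParallelQueues.isProbabilityMeasure_actionLaw hp
    exact ⟨ParallelQueues.steadyState H F p,
      ParallelQueues.isStationary_steadyState hH hF hstab,
      ParallelQueues.integrable_steadyState hH hF hstab,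
      fun π' hπ' => hπ'.eq_steadyState hH hF hstab⟩
  · have hanti : ∀ m, StrictAntiOn (ParallelQueues.stationValue H F R C m) (Set.Icc 0 1) :=
      fun m q hq q' hq' hlt => by
        have := mul_lt_mul_of_pos_left (ParallelQueues.strictMonoOn_meanWorkload hH (hF m)
          (hstab m) (hpos m) hq hq' hlt) hC
        simp only [ParallelQueues.stationValue, mul_add]
        linarith
    obtain ⟨p, hp⟩ := hex
    refine ⟨p, hp, fun p' hp' => ?_⟩
    exact ParallelQueues.IsEquilibrium.eq hanti
      ((ParallelQueues.isSymmetricNash_iff hH hF hstab R C p').1 hp')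
      ((ParallelQueues.isSymmetricNash_iff hH hF hstab R C p).1 hp)
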